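/- Let $\Phi$ be an irreducible (reduced) crystallographic root system spanning a Euclidean space $V$, with a simple system $\Delta$ and corresponding positive system $\Phi^+$. For $\alpha\in\Phi$ and $d\in\mathbb{Z}$ put $H_\alpha^d=\{x\in V:\langle x,\alpha\rangle=d\}$. The \emph{alcoves} are the connected components of the complement in $V$ of $\bigcup_{\alpha\in\Phi,\,d\in\mathbb{Z}}H_\alpha^d$. The \emph{Shi regions} are the connected components of the complement in $V$ of the union of the hyperplanes $H_\alpha^0$ and $H_\alpha^1$ with $\alpha\in\Phi^+$. For an alcove $A$ and $\alpha\in\Phi^+$ let $k(A,\alpha)$ be the unique integer $k$ with $k<\langle x,\alpha\rangle<k+1$ for all $x\in A$. The \emph{minimal alcove} of a Shi region $R$ is the alcove $A\subseteq R$ such that $|k(A,\alpha)|\le|k(B,\alpha)|$ for every alcove $B\subseteq R$ and every $\alpha\in\Phi^+$. (It exists and is unique by a theorem of Shi.) A \emph{wall} of an alcove or Shi region is an affine hyperplane that supports one of its facets, and a \emph{floor} is a wall that does not contain the origin and separates the alcove or region from the origin. Theorem. For every Shi region $R$, the floors of the minimal alcove of $R$ are exactly the floors of $R$. -/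

import Mathlib

noncomputable section

namespace ShiArrangement

section Hyperplanes

variable {V : Type*} [NormedAddCommGroup V] [InnerProductSpace ℝ V]

/-- The affine hyperplane `{x | ⟨x, a⟩ = c}`. -/
def hyperplane (a : V) (c : ℝ) : Set V := {x | inner ℝ x a = c}

/-- The complement of the union of the hyperplanes of an arrangement `𝒜`. -/
def complement (𝒜 : Set (Set V)) : Set V := (⋃₀ 𝒜)ᶜ

/-- `C` is a connected component of the complement of the arrangement `𝒜`. -/
def IsChamberOf (𝒜 : Set (Set V)) (C : Set V) : Prop :=
  ∃ x ∈ complement 𝒜, C = connectedComponentIn (complement 𝒜) x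

/-- `H` is a wall of `C`: an affine hyperplane that has `C` on one side and that supports a facet
of `C`, i.e. `H` meets the closure of `C` in a set that affinely spans the whole of `H`. -/
def IsWall (C H : Set V) : Prop :=
  ∃ (a : V) (c : ℝ), a ≠ 0 ∧ H = hyperplane a c ∧ (∀ x ∈ C, c ≤ inner ℝ x a) ∧
    (affineSpan ℝ (closure C ∩ H) : Set V) = H

/-- The hyperplane `H` separates the set `C` from the point `y`: they lie strictly on
different sides of `H`. -/
def Separates (H C : Set V) (y : V) : Prop :=
  ∃ (a : V) (c : ℝ), a ≠ 0 ∧ H = hyperplane a c ∧ (∀ x ∈ C, c < inner ℝ x a) ∧ inner ℝ y a < c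

/-- `H` is a floor of `C`: a wall of `C` that does not contain the origin and separates `C` from
the origin. -/
def IsFloor (C H : Set V) : Prop :=
  IsWall C H ∧ (0 : V) ∉ H ∧ Separates H C 0

end Hyperplanes

section Roots

variable {ι V : Type*} [NormedAddCommGroup V] [InnerProductSpace ℝ V]

/-- The root pairing `P` is realised in the Euclidean space `V`: the pairing of `V` with itself is
the inner product, and the coroot of each root `α` is `2 α / ⟨α, α⟩` (so that the reflection
of `P` attached to `α` is the orthogonal reflection in the hyperplane `⟨x, α⟩ = 0`). -/
structure IsEuclidean (P : RootPairing ι ℝ V V) : Prop where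
  toLinearMap_apply : ∀ x y : V, P.toLinearMap x y = inner ℝ x y
  coroot_eq : ∀ i : ι, P.coroot i = (2 / inner ℝ (P.root i) (P.root i) : ℝ) • P.root i

/-- The affine Coxeter arrangement: all `⟨x, α⟩ = d` for `α` a root and `d` an integer. -/
def affineCoxeterArrangement (P : RootPairing ι ℝ V V) : Set (Set V) :=
  {H | ∃ (i : ι) (d : ℤ), H = hyperplane (P.root i) d}

/-- The Shi arrangement: all `⟨x, α⟩ = 0` and `⟨x, α⟩ = 1` for `α` a positive root. -/
def shiArrangement {P : RootPairing ι ℝ V V} (b : P.Base) : Set (Set V) :=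
  {H | ∃ i : ι, b.IsPos i ∧ (H = hyperplane (P.root i) 0 ∨ H = hyperplane (P.root i) 1)}

/-- An alcove is a connected component of the complement of the affine Coxeter arrangement. -/
def IsAlcove (P : RootPairing ι ℝ V V) (A : Set V) : Prop :=
  IsChamberOf (affineCoxeterArrangement P) A

/-- A (Shi) region is a connected component of the complement of the Shi arrangement. -/
def IsShiRegion {P : RootPairing ι ℝ V V} (b : P.Base) (R : Set V) : Prop :=
  IsChamberOf (shiArrangement b) R

/-- For an alcove `A` and a root `α` there is a unique integer `k` such that
`k < ⟨x, α⟩ < k + 1` for all `x ∈ A`. -/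
theorem existsUnique_level {P : RootPairing ι ℝ V V} {A : Set V} (hA : IsAlcove P A) (i : ι) :
    ∃! k : ℤ, ∀ x ∈ A, (k : ℝ) < inner ℝ x (P.root i) ∧ inner ℝ x (P.root i) < (k : ℝ) + 1 := by
  obtain ⟨x, hx, rfl⟩ := hA
  have hxA := mem_connectedComponentIn hx
  have hne : ∀ y ∈ connectedComponentIn (complement (affineCoxeterArrangement P)) x, ∀ d : ℤ,
      inner ℝ y (P.root i) ≠ (d : ℝ) := by
    intro y hy d h
    exact connectedComponentIn_subset _ _ hy ⟨_, ⟨i, d, rfl⟩, h⟩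
  have hconn := (isPreconnected_connectedComponentIn
    (F := complement (affineCoxeterArrangement P)) (x := x)).image
    (fun y => inner ℝ y (P.root i)) (by fun_prop)
  have hord := hconn.ordConnected
  refine ⟨⌊inner ℝ x (P.root i)⌋, fun y hy => ⟨?_, ?_⟩, fun k hk => ?_⟩
  · by_contra! h
    obtain ⟨z, hz, hz'⟩ := hord.out ⟨y, hy, rfl⟩ ⟨x, hxA, rfl⟩ ⟨h, Int.floor_le _⟩
    exact hne z hz _ hz'
  · by_contra! h
    obtain ⟨z, hz, hz'⟩ := hord.out ⟨x, hxA, rfl⟩ ⟨y, hy, rfl⟩ ⟨(Int.lt_floor_add_one _).le, h⟩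
    exact hne z hz (⌊inner ℝ x (P.root i)⌋ + 1) (by simpa using hz')
  · exact (Int.floor_eq_iff.2 ⟨(hk x hxA).1.le, (hk x hxA).2⟩).symm

/-- The integer `k(A, α)` such that `k < ⟨x, α⟩ < k + 1` for all `x` in the alcove `A`
(it exists and is unique by `existsUnique_level`). -/
def level (P : RootPairing ι ℝ V V) (A : Set V) (i : ι) : ℤ :=
  Classical.epsilon fun k : ℤ =>
    ∀ x ∈ A, (k : ℝ) < inner ℝ x (P.root i) ∧ inner ℝ x (P.root i) < (k : ℝ) + 1

theorem level_spec {P : RootPairing ι ℝ V V} {A : Set V} (hA : IsAlcove P A) (i : ι) :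
    ∀ x ∈ A, (level P A i : ℝ) < inner ℝ x (P.root i) ∧
      inner ℝ x (P.root i) < (level P A i : ℝ) + 1 :=
  Classical.epsilon_spec (existsUnique_level hA i).exists

/-- `A` is the minimal alcove of the region `R`, the alcove in `R` closest to the origin:
`A ⊆ R`, and `|k(A, α)| ≤ |k(B, α)|` for every alcove `B ⊆ R` and every positive root `α`. -/
def IsMinimalAlcove {P : RootPairing ι ℝ V V} (b : P.Base) (R A : Set V) : Prop :=
  IsAlcove P A ∧ A ⊆ R ∧
    ∀ B : Set V, IsAlcove P B → B ⊆ R → ∀ i : ι, b.IsPos i → |level P A i| ≤ |level P B i|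

end Roots

end ShiArrangement

end

/-!
The region and its minimal alcove are described by inequalities `n < ⟨y, α⟩`, one for each root `α`
(positive or negative) and each level `n` of the arrangement with `n < ⟨x, α⟩`, where `x` is a fixed
point of the minimal alcove `A`; see `connectedComponentIn_complement_eq_levelRegion`. Such a set is an
open polyhedron, and its floors are the hyperplanes of the inequalities with `n > 0` that support a
facet (`isFloor_levelRegion_iff`). The minimality of `A` says that among all alcoves of the region `R` it
has the least level for each root that is positive on `R`.

A floor of `A` is a hyperplane of the Shi arrangement, since crossing any other floor would lead to
an alcove of `R` with a smaller level; a point of `A`'s facet satisfies all other inequalities of `R`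
strictly, so the floor is one of `R` (`isRegionFacet_of_isRegionFacet_true`).

Conversely, let `⟨y, α⟩ = 1` be a floor of `R`. A generic point of this facet shows that some alcove
of `R` has this floor. Choose one, `B`, for which the sum of the absolute values of the levels is
least. If `B ≠ A`, a facet `⟨y, η⟩ = m` of `B` separates `B` from `A`; by minimality of `A` the root
`η` is positive on `R` and `m ≥ 1`, and the hyperplane is not in the Shi arrangement. As the angles
between the facets of an alcove are not obtuse, the two facets meet in a face of codimension two
(`exists_mem_inter_of_isFacet`), and the roots whose hyperplanes contain this face are, together with
their levels, the combinations `u (α, 1) + v (η, m)` with natural `u` and `v`, up to sign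
(`exists_nat_combination`). The level `u + v m` is at least `2` unless the hyperplane is one of the
two given ones, so the only hyperplane of the Shi arrangement through the face is `⟨y, α⟩ = 1`. The
alcove at the other end of the half-space `⟨y, α⟩ > 1` around the face hence lies in `R`, has the
floor `⟨y, α⟩ = 1`, and has smaller levels (`exists_sum_natAbs_lt`): a contradiction.
-/

/-! ### Open polyhedra -/

section Polyhedra

variable {ι V : Type*} [NormedAddCommGroup V] [InnerProductSpace ℝ V]

/-- A family of vectors with those properties of a reduced crystallographic root system in a
Euclidean space that the argument uses. Roots are indexed, so that `sub_mem` and `neg_mem` are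
phrased with an index. -/
structure IsRootFamily (α : ι → V) : Prop where
  ne_zero : ∀ i, α i ≠ 0
  eq_or_neg : ∀ i j (c : ℝ), α j = c • α i → j = i ∨ α j = -α i
  neg_mem : ∀ i, ∃ j, α j = -α i
  sub_mem : ∀ i j, i ≠ j → 0 < inner ℝ (α i) (α j) → ∃ l, α l = α i - α j

/-- The open polyhedron cut out by the inequalities `k i < ⟨y, α i⟩` for `i ∈ J`. -/
def openPolyhedron (α : ι → V) (J : Set ι) (k : ι → ℝ) : Set V :=
  {y | ∀ i ∈ J, k i < inner ℝ y (α i)}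

/-- The inequality with index `i` supports a facet of `openPolyhedron α J k`: some point attains
equality in it and satisfies all other inequalities strictly. -/
def IsFacet (α : ι → V) (J : Set ι) (k : ι → ℝ) (i : ι) : Prop :=
  i ∈ J ∧ ∃ p : V, inner ℝ p (α i) = k i ∧ ∀ j ∈ J, j ≠ i → k j < inner ℝ p (α j)

variable {α : ι → V} {J : Set ι} {k : ι → ℝ}

lemma convex_openPolyhedron : Convex ℝ (openPolyhedron α J k) := by
  intro x hx y hy a b ha hb hab i hi
  have h1 := hx i hi
  have h2 := hy i hi
  rw [inner_add_left, real_inner_smul_left, real_inner_smul_left]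
  obtain rfl : b = 1 - a := by linarith
  rcases ha.eq_or_lt with rfl | ha
  · linarith
  · nlinarith [mul_lt_mul_of_pos_left h1 ha, mul_le_mul_of_nonneg_left h2.le hb]

lemma isOpen_openPolyhedron [Finite ι] : IsOpen (openPolyhedron α J k) := by
  have : openPolyhedron α J k = ⋂ i ∈ J, {y | k i < inner ℝ y (α i)} := by
    ext y; simp [openPolyhedron]
  rw [this]
  exact J.toFinite.isOpen_biInter fun i _ => isOpen_lt continuous_const (by fun_prop)

/-- A finite set of strict inequalities satisfied at `p` survives a small move in the
direction `d`. -/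
lemma exists_pos_forall_lt_inner_add_smul [Finite ι] (p d : V) (J : Set ι) (k : ι → ℝ)
    (h : ∀ i ∈ J, k i < inner ℝ p (α i)) {δ : ℝ} (hδ : 0 < δ) :
    ∃ t : ℝ, 0 < t ∧ t < δ ∧ ∀ s : ℝ, 0 ≤ s → s ≤ t → ∀ i ∈ J,
      k i < inner ℝ (p + s • d) (α i) := by
  have hc : Continuous fun s : ℝ => p + s • d := by fun_prop
  have hmem : (fun s : ℝ => p + s • d) ⁻¹' openPolyhedron α J k ∈ nhds (0 : ℝ) :=
    (isOpen_openPolyhedron.preimage hc).mem_nhds (by simpa [openPolyhedron] using h)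
  obtain ⟨ε, hε, hb⟩ := Metric.mem_nhds_iff.1 hmem
  refine ⟨min (ε / 2) (δ / 2), by positivity, by
    linarith [min_le_right (ε / 2) (δ / 2)], fun s hs hst i hi => ?_⟩
  have : s ∈ Metric.ball (0 : ℝ) ε := by
    rw [mem_ball_zero_iff, Real.norm_of_nonneg hs]
    linarith [min_le_left (ε / 2) (δ / 2)]
  exact hb this i hi

lemma mem_closure_openPolyhedron_iff {x y : V} (hx : x ∈ openPolyhedron α J k) :
    y ∈ closure (openPolyhedron α J k) ↔ ∀ i ∈ J, k i ≤ inner ℝ y (α i) := by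
  constructor
  · intro hy i hi
    have hcl : IsClosed {z : V | k i ≤ inner ℝ z (α i)} :=
      isClosed_le continuous_const (by fun_prop)
    exact closure_minimal (fun z hz => (hz i hi).le) hcl hy
  · intro hy
    have hc : Continuous fun t : ℝ => y + t • (x - y) := by fun_prop
    have h0 : (0 : ℝ) ∈ closure (Set.Ioo (0 : ℝ) 1) := by
      rw [closure_Ioo (by norm_num)]; simp
    have := map_mem_closure hc h0 (t := openPolyhedron α J k) fun t ht i hi => by
      rw [inner_add_left, real_inner_smul_left, inner_sub_left]
      nlinarith [hy i hi, mul_lt_mul_of_pos_left (hx i hi) ht.1,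
        mul_le_mul_of_nonneg_left (hy i hi) (sub_nonneg.2 ht.2.le)]
    simpa using this

/-- In a convex set on which finitely many functionals are bounded below, some point lies strictly
above every one of the bounds that is not attained identically. -/
lemma exists_forall_lt_of_exists_lt {D : Set V} (hD : Convex ℝ D) (hne : D.Nonempty)
    {J : Set ι} (hJ : J.Finite) (hle : ∀ y ∈ D, ∀ j ∈ J, k j ≤ inner ℝ y (α j)) :
    ∃ z ∈ D, ∀ j ∈ J, (∃ y ∈ D, k j < inner ℝ y (α j)) → k j < inner ℝ z (α j) := by
  induction J, hJ using Set.Finite.induction_on with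
  | empty => exact ⟨hne.some, hne.some_mem, by simp⟩
  | @insert a s _ _ ih =>
    obtain ⟨z, hz, hzs⟩ := ih fun y hy j hj => hle y hy j (Set.mem_insert_of_mem _ hj)
    by_cases h : ∃ y ∈ D, k a < inner ℝ y (α a)
    · obtain ⟨y, hy, hya⟩ := h
      refine ⟨(1 / 2 : ℝ) • z + (1 / 2 : ℝ) • y,
        hD hz hy (by norm_num) (by norm_num) (by norm_num), fun j hj hj' => ?_⟩
      rw [inner_add_left, real_inner_smul_left, real_inner_smul_left]
      rcases Set.mem_insert_iff.1 hj with rfl | hjs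
      · linarith [hle z hz j hj]
      · linarith [hzs j hjs hj', hle y hy j hj]
    · refine ⟨z, hz, fun j hj hj' => ?_⟩
      rcases Set.mem_insert_iff.1 hj with rfl | hjs
      · exact absurd hj' h
      · exact hzs j hjs hj'

namespace ShiArrangement

lemma exists_inner_eq {a : V} (ha : a ≠ 0) (c : ℝ) : ∃ x : V, inner ℝ x a = c :=
  ⟨(c / inner ℝ a a) • a, by
    rw [real_inner_smul_left, div_mul_cancel₀ _ (inner_self_ne_zero.2 ha)]⟩

lemma exists_eq_smul_of_hyperplane_subset {a b : V} {c d : ℝ} (ha : a ≠ 0) (hb : b ≠ 0)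
    (h : hyperplane a c ⊆ hyperplane b d) : ∃ r : ℝ, r ≠ 0 ∧ b = r • a ∧ d = r * c := by
  obtain ⟨x, hx⟩ := exists_inner_eq ha c
  have haa : inner ℝ a a ≠ 0 := inner_self_ne_zero.2 ha
  set r : ℝ := inner ℝ b a / inner ℝ a a with hr
  -- Moving from `x` along the component of `b` orthogonal to `a` stays in the first hyperplane.
  have h1 : inner ℝ (b - r • a) a = 0 := by
    rw [inner_sub_left, real_inner_smul_left, hr, div_mul_cancel₀ _ haa, sub_self]
  have hxd : inner ℝ x b = d := h hx
  have h2 : inner ℝ (x + (b - r • a)) b = d := h (by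
    change inner ℝ (x + (b - r • a)) a = c
    rw [inner_add_left, h1, hx, add_zero])
  have h3 : inner ℝ (b - r • a) b = 0 := by
    rw [inner_add_left, hxd] at h2; linarith
  have h4 : b - r • a = 0 := by
    rw [← inner_self_eq_zero (𝕜 := ℝ), inner_sub_right, h3, real_inner_smul_right, h1]; simp
  have h5 : b = r • a := sub_eq_zero.1 h4
  refine ⟨r, ?_, h5, ?_⟩
  · intro h0; rw [h0, zero_smul] at h5; exact hb h5
  · rw [← hxd, ← hx]
    conv_lhs => rw [h5]
    rw [real_inner_smul_right]

/-- The affine subspace underlying a hyperplane. -/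
def hyperplaneSubspace (a : V) (c : ℝ) : AffineSubspace ℝ V where
  carrier := hyperplane a c
  smul_vsub_vadd_mem' := by
    intro t p₁ p₂ p₃ h1 h2 h3
    simp only [hyperplane, Set.mem_ofPred_eq] at *
    simp [inner_add_left, inner_sub_left, real_inner_smul_left, h1, h2, h3]

/-- The walls of a nonempty open polyhedron are the hyperplanes of its facet inequalities. -/
theorem isWall_openPolyhedron_iff [Finite ι] (h0 : ∀ i, α i ≠ 0)
    (hpar : ∀ i j (c : ℝ), α j = c • α i → j = i ∨ α j = -α i) {x : V}
    (hx : x ∈ openPolyhedron α J k) (H : Set V) :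
    IsWall (openPolyhedron α J k) H ↔ ∃ i, IsFacet α J k i ∧ H = hyperplane (α i) (k i) := by
  constructor
  · rintro ⟨a, c, ha, rfl, hside, hspan⟩
    set D := closure (openPolyhedron α J k) ∩ hyperplane a c with hDdef
    have hHconv : Convex ℝ (hyperplane a c) := (hyperplaneSubspace a c).convex
    have hD : Convex ℝ D := convex_openPolyhedron.closure.inter hHconv
    have hne : D.Nonempty := by
      rw [← affineSpan_nonempty ℝ, hspan]
      exact exists_inner_eq ha c
    have hle : ∀ y ∈ D, ∀ j ∈ J, k j ≤ inner ℝ y (α j) := fun y hy =>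
      (mem_closure_openPolyhedron_iff hx).1 hy.1
    obtain ⟨z, hz, hzJ⟩ := exists_forall_lt_of_exists_lt hD hne J.toFinite hle
    -- A constraint that is attained identically on `D` has the wall as its hyperplane.
    have key : ∀ j ∈ J, ¬ (∃ y ∈ D, k j < inner ℝ y (α j)) →
        hyperplane a c ⊆ hyperplane (α j) (k j) := by
      intro j hj hno
      push Not at hno
      rw [← hspan]
      have : D ⊆ (hyperplaneSubspace (α j) (k j) : Set V) := fun y hy =>
        le_antisymm (hno y hy) (hle y hy j hj)
      exact affineSpan_le.2 this
    by_cases hall : ∀ j ∈ J, ∃ y ∈ D, k j < inner ℝ y (α j)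
    · exfalso
      -- Otherwise `z` would be an interior point on the supporting hyperplane.
      have hzC : z ∈ openPolyhedron α J k := fun j hj => hzJ j hj (hall j hj)
      obtain ⟨t, ht, -, hts⟩ := exists_pos_forall_lt_inner_add_smul z (-a) J k hzC one_pos
      have h1 := hside _ (hts t ht.le le_rfl)
      have h2 : inner ℝ z a = c := hz.2
      rw [inner_add_left, real_inner_smul_left, inner_neg_left, h2] at h1
      nlinarith [real_inner_self_pos.2 ha]
    · push Not at hall
      obtain ⟨i, hi, hno⟩ := hall
      have hsub := key i hi (by push Not; exact hno)
      obtain ⟨r, hr, hra, hrc⟩ := exists_eq_smul_of_hyperplane_subset ha (h0 i) hsub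
      have hEq : hyperplane a c = hyperplane (α i) (k i) := by
        refine hsub.antisymm fun y hy => ?_
        have hy' : inner ℝ y (α i) = k i := hy
        rw [hra, hrc, real_inner_smul_right] at hy'
        exact mul_left_cancel₀ hr hy'
      refine ⟨i, ⟨hi, z, ?_, fun j hj hji => ?_⟩, hEq⟩
      · have : z ∈ hyperplane (α i) (k i) := hEq ▸ hz.2
        exact this
      · apply hzJ j hj
        by_contra hcon
        have hs := key j hj hcon
        rw [hEq] at hs
        obtain ⟨s, _, hsa, hsc⟩ := exists_eq_smul_of_hyperplane_subset (h0 i) (h0 j) hs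
        rcases hpar i j s hsa with h | h
        · exact hji h
        · have hs1 : s = -1 := by
            rw [h, eq_comm, ← neg_one_smul ℝ (α i)] at hsa
            exact smul_left_injective ℝ (h0 i) hsa
          have h1 := hx i hi
          have h2 := hx j hj
          rw [h, hsc, hs1, inner_neg_right] at h2
          linarith
  · rintro ⟨i, ⟨hi, p, hp, hpj⟩, rfl⟩
    refine ⟨α i, k i, h0 i, rfl, fun y hy => (hy i hi).le, ?_⟩
    apply Set.Subset.antisymm
    · exact (affineSpan_le (Q := hyperplaneSubspace (α i) (k i))).2 Set.inter_subset_right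
    · intro y hy
      have hyi : inner ℝ y (α i) = k i := hy
      obtain ⟨t, ht, -, hts⟩ := exists_pos_forall_lt_inner_add_smul p (y - p) {j | j ∈ J ∧ j ≠ i} k
        (fun j hj => hpj j hj.1 hj.2) one_pos
      have hmem : ∀ s : ℝ, 0 ≤ s → s ≤ t →
          p + s • (y - p) ∈ closure (openPolyhedron α J k) ∩ hyperplane (α i) (k i) := by
        intro s hs hst
        have hi' : inner ℝ (p + s • (y - p)) (α i) = k i := by
          rw [inner_add_left, real_inner_smul_left, inner_sub_left, hp, hyi]; ring
        refine ⟨(mem_closure_openPolyhedron_iff hx).2 fun j hj => ?_, hi'⟩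
        rcases eq_or_ne j i with rfl | hji
        · exact hi'.ge
        · exact (hts s hs hst j ⟨hj, hji⟩).le
      have hp' := subset_affineSpan ℝ _ (hmem 0 le_rfl ht.le)
      have hq' := subset_affineSpan ℝ _ (hmem t ht.le le_rfl)
      have := AffineMap.lineMap_mem t⁻¹ hp' hq'
      rw [zero_smul, add_zero, AffineMap.lineMap_apply] at this
      simpa [smul_smul, inv_mul_cancel₀ ht.ne'] using this

/-- The floors of a nonempty open polyhedron are the hyperplanes of those facet inequalities that
fail at the origin. -/
theorem isFloor_openPolyhedron_iff [Finite ι] (h0 : ∀ i, α i ≠ 0)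
    (hpar : ∀ i j (c : ℝ), α j = c • α i → j = i ∨ α j = -α i) {x : V}
    (hx : x ∈ openPolyhedron α J k) (H : Set V) :
    IsFloor (openPolyhedron α J k) H ↔
      ∃ i, IsFacet α J k i ∧ 0 < k i ∧ H = hyperplane (α i) (k i) := by
  rw [IsFloor, isWall_openPolyhedron_iff h0 hpar hx]
  constructor
  · rintro ⟨⟨i, hi, rfl⟩, -, a, c, ha, hH, hside, h0c⟩
    refine ⟨i, hi, ?_, rfl⟩
    obtain ⟨r, -, hra, hrc⟩ := exists_eq_smul_of_hyperplane_subset (h0 i) ha hH.le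
    have h1 := hside x hx
    have h2 := hx i hi.1
    rw [hra, hrc, real_inner_smul_right] at h1
    rw [inner_zero_left, hrc] at h0c
    have hr : 0 < r := by
      by_contra! hr
      nlinarith
    exact pos_of_mul_pos_right h0c hr.le
  · rintro ⟨i, hi, hk, rfl⟩
    refine ⟨⟨i, hi, rfl⟩, ?_, α i, k i, h0 i, rfl, fun y hy => hy i hi.1, by simpa using hk⟩
    simp only [hyperplane, Set.mem_ofPred_eq, inner_zero_left]
    exact hk.ne

end ShiArrangement

lemma exists_orthogonal_inner_neg {a b : V} (ha : a ≠ 0) (h : ∀ c : ℝ, b ≠ c • a) :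
    ∃ d : V, inner ℝ d a = 0 ∧ inner ℝ d b < 0 := by
  have haa : inner ℝ a a ≠ 0 := inner_self_ne_zero.2 ha
  set r : ℝ := inner ℝ b a / inner ℝ a a with hr
  have h1 : inner ℝ (b - r • a) a = 0 := by
    rw [inner_sub_left, real_inner_smul_left, hr, div_mul_cancel₀ _ haa, sub_self]
  have h2 : 0 < inner ℝ (b - r • a) (b - r • a) := real_inner_self_pos.2 (sub_ne_zero.2 (h r))
  rw [inner_sub_right, real_inner_smul_right, h1] at h2
  exact ⟨-(b - r • a), by rw [inner_neg_left, h1, neg_zero], by rw [inner_neg_left]; linarith⟩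

/-- An open polyhedron is cut out by its facet inequalities alone. -/
theorem mem_openPolyhedron_of_forall_isFacet [Finite ι] (h0 : ∀ i, α i ≠ 0)
    (hpar : ∀ i j (c : ℝ), α j = c • α i → j = i ∨ α j = -α i) {x y : V}
    (hx : x ∈ openPolyhedron α J k) (hy : ∀ i, IsFacet α J k i → k i < inner ℝ y (α i)) :
    y ∈ openPolyhedron α J k := by
  -- A minimal subsystem `T` with the same solutions consists of facet inequalities.
  obtain ⟨T, hTmin⟩ := (Set.toFinite {T : Set ι | T ⊆ J ∧
    openPolyhedron α T k = openPolyhedron α J k}).exists_minimal ⟨J, subset_rfl, rfl⟩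
  obtain ⟨hTJ, hT⟩ := hTmin.prop
  rw [← hT]
  intro i hi
  apply hy i
  refine ⟨hTJ hi, ?_⟩
  have hne : openPolyhedron α (T \ {i}) k ≠ openPolyhedron α J k := by
    intro h
    have := hTmin.le_of_le ⟨Set.sdiff_subset.trans hTJ, h⟩ Set.sdiff_subset hi
    exact this.2 rfl
  obtain ⟨z, hz, hzi⟩ : ∃ z ∈ openPolyhedron α (T \ {i}) k, inner ℝ z (α i) ≤ k i := by
    by_contra! hcon
    apply hne
    rw [← hT]
    apply Set.Subset.antisymm
    · intro z hz j hj
      rcases eq_or_ne j i with rfl | hji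
      · exact hcon z hz
      · exact hz j ⟨hj, hji⟩
    · exact fun z hz j hj => hz j hj.1
  -- The segment from `x` to `z` meets the hyperplane of `i` in a point `p`.
  have hxT : x ∈ openPolyhedron α T k := hT ▸ hx
  have hxi := hxT i hi
  set A : ℝ := inner ℝ x (α i) - k i with hA
  set B : ℝ := k i - inner ℝ z (α i) with hB
  have hAB : 0 < A + B := by linarith
  set p : V := (B / (A + B)) • x + (A / (A + B)) • z with hp
  have hpi : inner ℝ p (α i) = k i := by
    rw [hp, inner_add_left, real_inner_smul_left, real_inner_smul_left]
    field_simp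
    rw [hA, hB]; ring
  have hpT : p ∈ openPolyhedron α (T \ {i}) k :=
    convex_openPolyhedron (fun j hj => hxT j hj.1) hz (div_nonneg (by linarith) hAB.le)
      (div_nonneg (by linarith) hAB.le) (by field_simp; ring)
  have hcl : ∀ q ∈ openPolyhedron α (T \ {i}) k, inner ℝ q (α i) = k i →
      ∀ j ∈ J, k j ≤ inner ℝ q (α j) := by
    intro q hq hqi
    rw [← mem_closure_openPolyhedron_iff hx, ← hT, mem_closure_openPolyhedron_iff hxT]
    intro j hj
    rcases eq_or_ne j i with rfl | hji
    · exact hqi.ge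
    · exact (hq j ⟨hj, hji⟩).le
  refine ⟨p, hpi, fun j hj hji => (hcl p hpT hpi j hj).lt_of_ne fun heq => ?_⟩
  by_cases hneg : ∃ c : ℝ, α j = c • α i
  · obtain ⟨c, hc⟩ := hneg
    rcases hpar i j c hc with h | h
    · exact hji h
    · have h1 := hx j hj
      rw [h, inner_neg_right] at h1 heq
      linarith
  · -- If `j` were also tight at `p`, a small move inside the hyperplane of `i` would violate it.
    push Not at hneg
    obtain ⟨d, hd, hdj⟩ := exists_orthogonal_inner_neg (h0 i) hneg
    obtain ⟨t, ht, -, hts⟩ := exists_pos_forall_lt_inner_add_smul p d _ k hpT one_pos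
    have := hcl (p + t • d) (hts t ht.le le_rfl)
      (by rw [inner_add_left, real_inner_smul_left, hd, hpi]; ring) j hj
    rw [inner_add_left, real_inner_smul_left, ← heq] at this
    nlinarith

theorem le_inner_of_forall_isFacet [Finite ι] (h0 : ∀ i, α i ≠ 0)
    (hpar : ∀ i j (c : ℝ), α j = c • α i → j = i ∨ α j = -α i) {x y : V}
    (hx : x ∈ openPolyhedron α J k) (hy : ∀ i, IsFacet α J k i → k i ≤ inner ℝ y (α i)) :
    ∀ j ∈ J, k j ≤ inner ℝ y (α j) := by
  intro j hj
  by_contra! hlt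
  obtain ⟨t, ht, ht1, hts⟩ := exists_pos_forall_lt_inner_add_smul (α := fun i => -α i) y (x - y)
    {j} (fun i => -k i) (by simpa using hlt) one_pos
  have h1 := hts t ht.le le_rfl j rfl
  rw [inner_neg_right] at h1
  have h2 := mem_openPolyhedron_of_forall_isFacet h0 hpar hx (y := y + t • (x - y))
    (fun i hi => by
      rw [inner_add_left, real_inner_smul_left, inner_sub_left]
      nlinarith [hy i hi, mul_lt_mul_of_pos_left (hx i hi.1) ht,
        mul_le_mul_of_nonneg_left (hy i hi) (sub_nonneg.2 ht1.le)]) j hj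
  linarith

end Polyhedra

/-! ### Regions of arrangements of integer levels -/

section Regions

variable {ι V : Type*} [NormedAddCommGroup V] [InnerProductSpace ℝ V]

/-- The point `x` lies on none of the hyperplanes `⟨x, α i⟩ = d` with `d` an integer. -/
def IsGeneric (α : ι → V) (x : V) : Prop := ∀ i (d : ℤ), inner ℝ x (α i) ≠ d

/-- The region of the point `x` for the arrangement of the hyperplanes `⟨y, α i⟩ = n` with `E i n`,
described by the inequalities `n < ⟨y, α i⟩` that hold at `x`. The inequalities in the other
direction are covered when `E` is invariant under negation of roots and levels. -/
def levelRegion (α : ι → V) (E : ι → ℤ → Prop) (x : V) : Set V :=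
  {y | ∀ i (n : ℤ), E i n → (n : ℝ) < inner ℝ x (α i) → (n : ℝ) < inner ℝ y (α i)}

/-- The hyperplane `⟨y, α i⟩ = n` of the arrangement `E` supports a facet of the region of `x`,
which lies above it. -/
def IsRegionFacet (α : ι → V) (E : ι → ℤ → Prop) (x : V) (i : ι) (n : ℤ) : Prop :=
  E i n ∧ (n : ℝ) < inner ℝ x (α i) ∧ ∃ p : V, inner ℝ p (α i) = n ∧
    ∀ j (l : ℤ), E j l → (l : ℝ) < inner ℝ x (α j) → (j ≠ i ∨ l ≠ n) → (l : ℝ) < inner ℝ p (α j)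

/-- The levels `⌊⟨x, α i⟩⌋`, as real numbers; they define the alcove of a generic `x`. -/
noncomputable def levels (α : ι → V) (x : V) (i : ι) : ℝ := (⌊(inner ℝ x (α i) : ℝ)⌋ : ℤ)

variable {α : ι → V} {E : ι → ℤ → Prop} {x : V}

/-- A region is an open polyhedron: for each root only the largest relevant level matters. -/
lemma exists_levelRegion_eq_openPolyhedron (α : ι → V) (E : ι → ℤ → Prop) (x : V) :
    ∃ (J : Set ι) (k : ι → ℤ), levelRegion α E x = openPolyhedron α J (fun i => k i) ∧
      ∀ i n, IsRegionFacet α E x i n ↔ n = k i ∧ IsFacet α J (fun i => k i) i := by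
  have hmax : ∀ i, ∃ m : ℤ, (∃ n, E i n ∧ (n : ℝ) < inner ℝ x (α i)) →
      (E i m ∧ (m : ℝ) < inner ℝ x (α i)) ∧
        ∀ n, E i n ∧ (n : ℝ) < inner ℝ x (α i) → n ≤ m := by
    intro i
    by_cases h : ∃ n, E i n ∧ (n : ℝ) < inner ℝ x (α i)
    · obtain ⟨m, hm⟩ := Int.exists_greatest_of_bdd
        (P := fun n => E i n ∧ (n : ℝ) < inner ℝ x (α i))
        ⟨⌊(inner ℝ x (α i) : ℝ)⌋, fun z hz => Int.le_floor.2 hz.2.le⟩ h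
      exact ⟨m, fun _ => hm⟩
    · exact ⟨0, fun h' => absurd h' h⟩
  choose k hk using hmax
  refine ⟨{i | ∃ n, E i n ∧ (n : ℝ) < inner ℝ x (α i)}, k, ?_, fun i n => ⟨?_, ?_⟩⟩
  · ext y
    constructor
    · exact fun hy i hi => hy i (k i) (hk i hi).1.1 (hk i hi).1.2
    · intro hy i n hE hn
      have h1 := (hk i ⟨n, hE, hn⟩).2 n ⟨hE, hn⟩
      exact (Int.cast_le.2 h1).trans_lt (hy i ⟨n, hE, hn⟩)
  · rintro ⟨hE, hn, p, hp, hpj⟩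
    obtain ⟨⟨hk1, hk2⟩, hk3⟩ := hk i ⟨n, hE, hn⟩
    obtain rfl : n = k i := by
      by_contra hne
      have h1 := hpj i (k i) hk1 hk2 (Or.inr (Ne.symm hne))
      rw [hp, Int.cast_lt] at h1
      have h2 := hk3 n ⟨hE, hn⟩
      omega
    exact ⟨rfl, ⟨_, hE, hn⟩, p, hp, fun j hj hji =>
      hpj j (k j) (hk j hj).1.1 (hk j hj).1.2 (Or.inl hji)⟩
  · rintro ⟨rfl, hi, p, hp, hpj⟩
    obtain ⟨⟨hk1, hk2⟩, hk3⟩ := hk i hi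
    refine ⟨hk1, hk2, p, hp, fun j l hE hl hjl => ?_⟩
    rcases eq_or_ne j i with rfl | hji
    · rw [hp, Int.cast_lt]
      exact (hk3 l ⟨hE, hl⟩).lt_of_ne (hjl.resolve_left (by simp))
    · exact (Int.cast_le.2 ((hk j ⟨l, hE, hl⟩).2 l ⟨hE, hl⟩)).trans_lt (hpj j ⟨l, hE, hl⟩ hji)

lemma mem_levelRegion_self : x ∈ levelRegion α E x := fun _ _ _ h => h

theorem isFloor_levelRegion_iff [Finite ι] (hα : IsRootFamily α) (H : Set V) :
    ShiArrangement.IsFloor (levelRegion α E x) H ↔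
      ∃ i n, IsRegionFacet α E x i n ∧ 0 < n ∧ H = ShiArrangement.hyperplane (α i) n := by
  obtain ⟨J, k, hR, hF⟩ := exists_levelRegion_eq_openPolyhedron α E x
  have hx : x ∈ openPolyhedron α J (fun i => (k i : ℝ)) := hR ▸ mem_levelRegion_self
  rw [hR, ShiArrangement.isFloor_openPolyhedron_iff hα.ne_zero hα.eq_or_neg hx]
  simp_rw [hF]
  constructor
  · rintro ⟨i, hi, hpos, rfl⟩
    exact ⟨i, k i, ⟨rfl, hi⟩, by exact_mod_cast hpos, rfl⟩
  · rintro ⟨i, _, ⟨rfl, hi⟩, hpos, rfl⟩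
    exact ⟨i, hi, by exact_mod_cast hpos, rfl⟩

lemma IsGeneric.floor_lt (hx : IsGeneric α x) (i : ι) :
    ((⌊(inner ℝ x (α i) : ℝ)⌋ : ℤ) : ℝ) < inner ℝ x (α i) :=
  (Int.floor_le _).lt_of_ne (hx i _).symm

lemma IsGeneric.mem_openPolyhedron (hx : IsGeneric α x) :
    x ∈ openPolyhedron α Set.univ (levels α x) := fun i _ => hx.floor_lt i

/-- The facets of the alcove of a generic point. -/
lemma isRegionFacet_true_iff (hx : IsGeneric α x) (i : ι) (n : ℤ) :
    IsRegionFacet α (fun _ _ => True) x i n ↔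
      n = ⌊(inner ℝ x (α i) : ℝ)⌋ ∧ IsFacet α Set.univ (levels α x) i := by
  constructor
  · rintro ⟨-, hn, p, hp, hpj⟩
    obtain rfl : n = ⌊(inner ℝ x (α i) : ℝ)⌋ := by
      by_contra hne
      have h1 := hpj i _ trivial (hx.floor_lt i) (Or.inr (Ne.symm hne))
      rw [hp, Int.cast_lt] at h1
      exact absurd (Int.le_floor.2 hn.le) (not_le.2 h1)
    exact ⟨rfl, trivial, p, hp, fun j _ hji => hpj j _ trivial (hx.floor_lt j) (Or.inl hji)⟩
  · rintro ⟨rfl, -, p, hp, hpj⟩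
    refine ⟨trivial, hx.floor_lt i, p, hp, fun j l _ hl hjl => ?_⟩
    have hle : l ≤ ⌊(inner ℝ x (α j) : ℝ)⌋ := Int.le_floor.2 hl.le
    rcases eq_or_ne j i with rfl | hji
    · rw [hp, levels, Int.cast_lt]
      exact hle.lt_of_ne (hjl.resolve_left (by simp))
    · exact (Int.cast_le.2 hle).trans_lt (hpj j trivial hji)

lemma IsGeneric.floor_neg (hx : IsGeneric α x) {i j : ι} (h : α j = -α i) :
    ⌊(inner ℝ x (α j) : ℝ)⌋ = -⌊(inner ℝ x (α i) : ℝ)⌋ - 1 := by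
  rw [h, inner_neg_right, Int.floor_eq_iff]
  have h1 := hx.floor_lt i
  have h2 := Int.lt_floor_add_one (inner ℝ x (α i) : ℝ)
  push_cast
  constructor <;> linarith

/-- Levels that are strict lower bounds, and that are compatible with negation, are the levels of
a generic point. -/
lemma isGeneric_of_forall_lt (hα : IsRootFamily α) {k : ι → ℤ}
    (hneg : ∀ i j, α j = -α i → k j = -k i - 1) (h : ∀ i, (k i : ℝ) < inner ℝ x (α i)) :
    IsGeneric α x ∧ ∀ i, ⌊(inner ℝ x (α i) : ℝ)⌋ = k i := by
  have hlt : ∀ i, inner ℝ x (α i) < (k i : ℝ) + 1 := by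
    intro i
    obtain ⟨j, hj⟩ := hα.neg_mem i
    have := h j
    rw [hneg i j hj, hj, inner_neg_right] at this
    push_cast at this
    linarith
  refine ⟨fun i d hd => ?_, fun i => Int.floor_eq_iff.2 ⟨(h i).le, hlt i⟩⟩
  have h1 := h i
  have h2 := hlt i
  rw [hd] at h1 h2
  norm_cast at h1 h2
  omega

/-- The alcoves with a common system of levels agree: a point above all levels of `q` has the same
levels as `q`. -/
lemma floor_eq_of_mem_openPolyhedron (hα : IsRootFamily α) {q : V} (hq : IsGeneric α q)
    (hx : x ∈ openPolyhedron α Set.univ (levels α q)) (i : ι) :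
    ⌊(inner ℝ x (α i) : ℝ)⌋ = ⌊(inner ℝ q (α i) : ℝ)⌋ :=
  (isGeneric_of_forall_lt hα (fun _ _ h => hq.floor_neg h) fun i => hx i trivial).2 i

lemma IsRootFamily.injective (hα : IsRootFamily α) : Function.Injective α := by
  intro a b hab
  rcases hα.eq_or_neg b a 1 (by rw [hab, one_smul]) with h | h
  · exact h
  · have : IsAddTorsionFree V := .of_isTorsionFree ℝ V
    exact absurd (self_eq_neg.1 (hab.symm.trans h)) (hα.ne_zero b)

lemma IsRootFamily.neg_ne (hα : IsRootFamily α) {i j : ι} (h : α j = -α i) : j ≠ i := by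
  rintro rfl
  have : IsAddTorsionFree V := .of_isTorsionFree ℝ V
  exact hα.ne_zero _ (self_eq_neg.1 h)

/-- A point `p` on exactly one hyperplane `⟨y, α i⟩ = n` is a limit of points `q` in the alcove
just above it. The integer `⌈⟨p, α j⟩⌉ - 1` is the largest one below `⟨p, α j⟩`, which is the
correct level also for the root `-α i`. -/
lemma exists_generic_above_wall [Finite ι] (hα : IsRootFamily α) {p : V} {i : ι} {n : ℤ}
    (hp : inner ℝ p (α i) = n)
    (hpj : ∀ j, j ≠ i → α j ≠ -α i → ∀ d : ℤ, inner ℝ p (α j) ≠ d) :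
    ∃ q, IsGeneric α q ∧ ⌊(inner ℝ q (α i) : ℝ)⌋ = n ∧
      ∀ j, j ≠ i → ⌊(inner ℝ q (α j) : ℝ)⌋ = ⌈(inner ℝ p (α j) : ℝ)⌉ - 1 := by
  classical
  obtain ⟨t, ht, -, hts⟩ := exists_pos_forall_lt_inner_add_smul (α := α) p (α i) {j | j ≠ i}
    (fun j => ((⌈(inner ℝ p (α j) : ℝ)⌉ - 1 : ℤ) : ℝ))
    (fun j _ => by push_cast; linarith [Int.ceil_lt_add_one (inner ℝ p (α j) : ℝ)]) one_pos
  have hnn : ∀ j l, α l = -α j → j ≠ i → l ≠ i →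
      ⌈(inner ℝ p (α l) : ℝ)⌉ - 1 = -(⌈(inner ℝ p (α j) : ℝ)⌉ - 1) - 1 := by
    intro j l hjl hj hl
    have hj' : α j ≠ -α i := fun h => hl (hα.injective (by rw [hjl, h, neg_neg]))
    have h1 : (⌊(inner ℝ p (α j) : ℝ)⌋ : ℝ) < inner ℝ p (α j) :=
      (Int.floor_le _).lt_of_ne (hpj j hj hj' _).symm
    have h2 : ⌈(inner ℝ p (α j) : ℝ)⌉ = ⌊(inner ℝ p (α j) : ℝ)⌋ + 1 :=
      Int.ceil_eq_iff.2 ⟨by push_cast; linarith, by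
        push_cast; exact (Int.lt_floor_add_one _).le⟩
    rw [hjl, inner_neg_right, Int.ceil_neg]
    omega
  obtain ⟨hqg, hql⟩ := isGeneric_of_forall_lt (x := p + t • α i) hα
    (k := fun j => if j = i then n else ⌈(inner ℝ p (α j) : ℝ)⌉ - 1)
    (by
      intro j l hjl
      have hlj := hα.neg_ne hjl
      by_cases h1 : j = i
      · subst h1
        rw [if_neg hlj, if_pos rfl, hjl, inner_neg_right, hp, ← Int.cast_neg, Int.ceil_intCast]
      · by_cases h2 : l = i
        · subst h2
          have hlj : α j = -α l := by rw [hjl, neg_neg]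
          rw [if_pos rfl, if_neg h1, hlj, inner_neg_right, hp, ← Int.cast_neg, Int.ceil_intCast]
          ring
        · rw [if_neg h1, if_neg h2]
          exact hnn j l hjl h1 h2)
    (by
      intro j
      split_ifs with h1
      · rw [h1, inner_add_left, real_inner_smul_left, hp]
        linarith [mul_pos ht (real_inner_self_pos.2 (hα.ne_zero i))]
      · exact hts t ht.le le_rfl j h1)
  exact ⟨_, hqg, by rw [hql, if_pos rfl], fun j hj => by rw [hql, if_neg hj]⟩

end Regions

/-! ### Crossing the floors of the minimal alcove -/

section Minimal

variable {ι V : Type*} [NormedAddCommGroup V] [InnerProductSpace ℝ V]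
  {α : ι → V} {E : ι → ℤ → Prop} {x : V}

/-- Every floor of the minimal alcove is a floor of the region: crossing a floor that is not in the
arrangement would lower a level inside the region. -/
theorem isRegionFacet_of_isRegionFacet_true [Finite ι] (hα : IsRootFamily α) (hx : IsGeneric α x)
    (hmin : ∀ y, IsGeneric α y → y ∈ levelRegion α E x → ∀ i, 0 < inner ℝ x (α i) →
      ⌊(inner ℝ x (α i) : ℝ)⌋ ≤ ⌊(inner ℝ y (α i) : ℝ)⌋)
    {i : ι} {n : ℤ} (hF : IsRegionFacet α (fun _ _ => True) x i n) (hn : 0 < n) :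
    IsRegionFacet α E x i n := by
  obtain ⟨rfl, -, -⟩ := (isRegionFacet_true_iff hx i n).1 hF
  obtain ⟨-, hnx, p, hp, hpj⟩ := hF
  suffices hE : E i ⌊(inner ℝ x (α i) : ℝ)⌋ from
    ⟨hE, hnx, p, hp, fun j l _ => hpj j l trivial⟩
  by_contra hE
  have hlev : ∀ j, j ≠ i → (⌊(inner ℝ x (α j) : ℝ)⌋ : ℝ) < inner ℝ p (α j) :=
    fun j hj => hpj j _ trivial (hx.floor_lt j) (Or.inl hj)
  obtain ⟨i', hi'⟩ := hα.neg_mem i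
  -- The point `q` lies just below the floor, that is, just above it for the root `-α i`.
  obtain ⟨q, hqg, hqi, hqj⟩ := exists_generic_above_wall hα (p := p) (i := i')
    (n := -⌊(inner ℝ x (α i) : ℝ)⌋) (by rw [hi', inner_neg_right, hp, Int.cast_neg]) (by
      intro j hj hj' d hd
      have hji : j ≠ i := by rintro rfl; exact hj' (by rw [hi', neg_neg])
      obtain ⟨l, hl⟩ := hα.neg_mem j
      have hli : l ≠ i := by
        rintro rfl; exact hj (hα.injective (by rw [hi', hl, neg_neg]))
      have h1 := hlev j hji
      have h2 := hlev l hli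
      rw [hx.floor_neg hl, hl, inner_neg_right, hd] at h2
      rw [hd] at h1
      norm_cast at h1 h2
      omega)
  have hqi' : ⌊(inner ℝ q (α i) : ℝ)⌋ = ⌊(inner ℝ x (α i) : ℝ)⌋ - 1 := by
    rw [hqj i (hα.neg_ne hi').symm, hp, Int.ceil_intCast]
  have hqR : q ∈ levelRegion α E x := by
    intro j l hEl hl
    refine lt_of_le_of_lt (Int.cast_le.2 ?_) (hqg.floor_lt j)
    have hle : l ≤ ⌊(inner ℝ x (α j) : ℝ)⌋ := Int.le_floor.2 hl.le
    rcases eq_or_ne j i with rfl | hji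
    · have hne : l ≠ ⌊(inner ℝ x (α j) : ℝ)⌋ := by rintro rfl; exact hE hEl
      omega
    · rcases eq_or_ne j i' with rfl | hji'
      · rw [hx.floor_neg hi'] at hle
        omega
      · have h1 := Int.lt_ceil.2 (hlev j hji)
        rw [hqj j hji']
        omega
  have h1 := hmin q hqg hqR i (lt_trans (by exact_mod_cast hn) hnx)
  omega

end Minimal

/-! ### The codimension two face of two facets of an alcove -/

section Alcove

variable {ι V : Type*} [NormedAddCommGroup V] [InnerProductSpace ℝ V] {α : ι → V} {q : V}

/-- If two roots `β`, `γ` have positive inner product and the level of `γ` is a facet of the alcove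
of `q`, then the level of the root `β - γ` is at least the difference of the levels. -/
lemma floor_sub_le_floor_of_isFacet (hα : IsRootFamily α) (hq : IsGeneric α q) {b g l : ι}
    (hg : IsFacet α Set.univ (levels α q) g) (hbg : b ≠ g) (hl : α l = α b - α g) :
    ⌊(inner ℝ q (α b) : ℝ)⌋ - ⌊(inner ℝ q (α g) : ℝ)⌋ ≤ ⌊(inner ℝ q (α l) : ℝ)⌋ := by
  obtain ⟨-, p, hp, hpj⟩ := hg
  obtain ⟨l', hl'⟩ := hα.neg_mem l
  by_contra! hlt
  -- Otherwise the opposite root has a level that is too large at the facet point `p`.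
  have hne : l' ≠ g := by
    rintro rfl
    rw [hl, neg_sub, eq_comm, sub_eq_self] at hl'
    exact hα.ne_zero b hl'
  have h1 := hpj l' trivial hne
  have h2 := hpj b trivial hbg
  have h3 : inner ℝ p (α l) = inner ℝ p (α b) - levels α q g := by
    rw [hl, inner_sub_right, hp]
  have h4 : (⌊(inner ℝ q (α l) : ℝ)⌋ : ℝ) + 1 ≤
      ⌊(inner ℝ q (α b) : ℝ)⌋ - ⌊(inner ℝ q (α g) : ℝ)⌋ := by exact_mod_cast hlt
  rw [levels, hq.floor_neg hl', hl', inner_neg_right, h3] at h1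
  simp only [levels] at h1 h2
  push_cast at h1
  linarith

/-- Distinct facets of an alcove meet at non-obtuse interior angles. -/
lemma inner_nonpos_of_isFacet (hα : IsRootFamily α) (hq : IsGeneric α q) {i j : ι} (hij : i ≠ j)
    (hi : IsFacet α Set.univ (levels α q) i) (hj : IsFacet α Set.univ (levels α q) j) :
    inner ℝ (α i) (α j) ≤ 0 := by
  by_contra! hpos
  obtain ⟨l, hl⟩ := hα.sub_mem i j hij hpos
  obtain ⟨m, hm⟩ := hα.neg_mem l
  have h1 := floor_sub_le_floor_of_isFacet hα hq hj hij hl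
  have h2 := floor_sub_le_floor_of_isFacet hα hq hi hij.symm (hm.trans (by rw [hl, neg_sub]))
  rw [hq.floor_neg hm] at h2
  omega

/-- Two facets of an alcove with linearly independent roots meet in a face of codimension two: the
orthogonal projection of a point of the alcove to the intersection of the two hyperplanes lies
strictly inside the remaining facet inequalities, since the angles are non-obtuse. -/
lemma exists_mem_inter_of_isFacet (hα : IsRootFamily α) (hq : IsGeneric α q) {i h : ι}
    (hih : i ≠ h) (hneg : α h ≠ -α i)
    (hi : IsFacet α Set.univ (levels α q) i) (hh : IsFacet α Set.univ (levels α q) h) :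
    ∃ f : V, inner ℝ f (α i) = levels α q i ∧ inner ℝ f (α h) = levels α q h ∧
      ∀ j, IsFacet α Set.univ (levels α q) j → j ≠ i → j ≠ h →
        levels α q j < inner ℝ f (α j) := by
  have hA : 0 < inner ℝ (α i) (α i) := real_inner_self_pos.2 (hα.ne_zero i)
  have hD : 0 < inner ℝ (α h) (α h) := real_inner_self_pos.2 (hα.ne_zero h)
  have hc : inner ℝ (α i) (α h) ≤ 0 := inner_nonpos_of_isFacet hα hq hih hi hh
  have hdet : 0 < inner ℝ (α i) (α i) * inner ℝ (α h) (α h) -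
      inner ℝ (α i) (α h) * inner ℝ (α i) (α h) := by
    have h1 : 0 < inner ℝ (α h - (inner ℝ (α i) (α h) / inner ℝ (α i) (α i)) • α i)
        (α h - (inner ℝ (α i) (α h) / inner ℝ (α i) (α i)) • α i) := by
      refine real_inner_self_pos.2 (sub_ne_zero.2 fun hc' => ?_)
      exact (hα.eq_or_neg i h _ hc').elim hih.symm hneg
    simp only [inner_sub_left, inner_sub_right, real_inner_smul_left, real_inner_smul_right,
      real_inner_comm (α i) (α h)] at h1
    field_simp at h1
    nlinarith
  have ha := hq.floor_lt i
  have he := hq.floor_lt h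
  set A : ℝ := inner ℝ (α i) (α i)
  set D : ℝ := inner ℝ (α h) (α h)
  set c : ℝ := inner ℝ (α i) (α h) with hcdef
  set a : ℝ := inner ℝ q (α i) - levels α q i with hadef
  set e : ℝ := inner ℝ q (α h) - levels α q h with hedef
  have ha' : 0 < a := sub_pos.2 ha
  have he' : 0 < e := sub_pos.2 he
  have hci : inner ℝ (α h) (α i) = c := real_inner_comm _ _
  set s : ℝ := (D * a - c * e) / (A * D - c * c) with hs
  set t : ℝ := (A * e - c * a) / (A * D - c * c) with ht
  have hs0 : 0 ≤ s := div_nonneg (by nlinarith) hdet.le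
  have ht0 : 0 ≤ t := div_nonneg (by nlinarith) hdet.le
  refine ⟨q - s • α i - t • α h, ?_, ?_, fun j hj hji hjh => ?_⟩
  · rw [inner_sub_left, inner_sub_left, real_inner_smul_left, real_inner_smul_left, hci]
    have : s * A + t * c = a := by
      rw [hs, ht, div_mul_eq_mul_div, div_mul_eq_mul_div, ← add_div, div_eq_iff hdet.ne']; ring
    change _ - s * A - t * c = _
    linarith
  · rw [inner_sub_left, inner_sub_left, real_inner_smul_left, real_inner_smul_left]
    have : s * c + t * D = e := by
      rw [hs, ht, div_mul_eq_mul_div, div_mul_eq_mul_div, ← add_div, div_eq_iff hdet.ne']; ring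
    change _ - s * c - t * D = _
    linarith
  · rw [inner_sub_left, inner_sub_left, real_inner_smul_left, real_inner_smul_left]
    have h1 := inner_nonpos_of_isFacet hα hq hji.symm hi hj
    have h2 := inner_nonpos_of_isFacet hα hq hjh.symm hh hj
    have h3 : levels α q j < inner ℝ q (α j) := hq.floor_lt j
    nlinarith [mul_nonneg hs0 (neg_nonneg.2 h1), mul_nonneg ht0 (neg_nonneg.2 h2)]

/-- Near the face of codimension two in which the facets `i` and `h` meet, the alcove is a chamber
of a dihedral arrangement with simple roots `i` and `h`: every root whose level is attained on the
face is, together with its level, a combination of these two with natural coefficients. -/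
lemma exists_nat_combination [Finite ι] (hα : IsRootFamily α) (hq : IsGeneric α q) {i h : ι}
    {f : V} (hi : IsFacet α Set.univ (levels α q) i) (hh : IsFacet α Set.univ (levels α q) h)
    (hfi : inner ℝ f (α i) = levels α q i) (hfh : inner ℝ f (α h) = levels α q h)
    (hf : ∀ j, IsFacet α Set.univ (levels α q) j → j ≠ i → j ≠ h →
        levels α q j < inner ℝ f (α j)) (b : ι) (hb : inner ℝ f (α b) = levels α q b) :
    ∃ u v : ℕ, α b = (u : ℝ) • α i + (v : ℝ) • α h ∧
      ⌊(inner ℝ q (α b) : ℝ)⌋ = u * ⌊(inner ℝ q (α i) : ℝ)⌋ + v * ⌊(inner ℝ q (α h) : ℝ)⌋ := by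
  have hle : ∀ j, levels α q j ≤ inner ℝ f (α j) := fun j =>
    le_inner_of_forall_isFacet hα.ne_zero hα.eq_or_neg hq.mem_openPolyhedron (fun g hg => by
      by_cases h1 : g = i
      · exact (h1 ▸ hfi).ge
      · by_cases h2 : g = h
        · exact (h2 ▸ hfh).ge
        · exact (hf g hg h1 h2).le) j trivial
  -- Induction on the height of `q` above the level of the root.
  set φ : ι → ℝ := fun j => inner ℝ q (α j) - levels α q j with hφ
  have hwf : WellFounded fun a b : ι => φ a < φ b :=
    haveI : IsTrans ι fun a b => φ a < φ b := ⟨fun _ _ _ => lt_trans⟩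
    haveI : Std.Irrefl fun a b : ι => φ a < φ b := ⟨fun _ => lt_irrefl _⟩
    Finite.wellFounded_of_trans_of_irrefl _
  induction b using hwf.induction with
  | _ b ih =>
  -- Subtracting a facet root of the face stays among the roots attained on the face.
  have step : ∀ g, IsFacet α Set.univ (levels α q) g → inner ℝ f (α g) = levels α q g → b ≠ g →
      0 < inner ℝ (α b) (α g) → ∃ l, α l = α b - α g ∧
        ⌊(inner ℝ q (α l) : ℝ)⌋ = ⌊(inner ℝ q (α b) : ℝ)⌋ - ⌊(inner ℝ q (α g) : ℝ)⌋ ∧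
        inner ℝ f (α l) = levels α q l ∧ φ l < φ b := by
    intro g hg hfg hbg hpos
    obtain ⟨l, hl⟩ := hα.sub_mem b g hbg hpos
    have h1 := floor_sub_le_floor_of_isFacet hα hq hg hbg hl
    have h2 : inner ℝ f (α l) = levels α q b - levels α q g := by
      rw [hl, inner_sub_right, hb, hfg]
    have h3 := hle l
    rw [h2] at h3
    simp only [levels] at h3
    have h4 : ⌊(inner ℝ q (α l) : ℝ)⌋ = ⌊(inner ℝ q (α b) : ℝ)⌋ - ⌊(inner ℝ q (α g) : ℝ)⌋ :=
      le_antisymm (by exact_mod_cast h3) h1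
    have h5 : levels α q l = levels α q b - levels α q g := by
      rw [levels, h4, Int.cast_sub]; rfl
    refine ⟨l, hl, h4, h2.trans h5.symm, ?_⟩
    simp only [hφ, h5]
    rw [hl, inner_sub_right]
    have h6 : levels α q g < inner ℝ q (α g) := hq.floor_lt g
    linarith
  by_cases hbi : b = i
  · exact ⟨1, 0, by simp [hbi], by simp [hbi]⟩
  by_cases hbh : b = h
  · exact ⟨0, 1, by simp [hbh], by simp [hbh]⟩
  have hpos : 0 < inner ℝ (α b) (α i) ∨ 0 < inner ℝ (α b) (α h) := by
    by_contra! hcon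
    -- Otherwise moving from the face in the direction `-β` stays in the closed alcove.
    obtain ⟨t, ht, -, hts⟩ := exists_pos_forall_lt_inner_add_smul f (-α b)
      {j | IsFacet α Set.univ (levels α q) j ∧ j ≠ i ∧ j ≠ h} (levels α q)
      (fun j hj => hf j hj.1 hj.2.1 hj.2.2) one_pos
    have h1 := le_inner_of_forall_isFacet hα.ne_zero hα.eq_or_neg hq.mem_openPolyhedron
      (y := f + t • (-α b)) (fun g hg => by
        by_cases h1 : g = i
        · rw [h1, inner_add_left, real_inner_smul_left, inner_neg_left, hfi]
          nlinarith [hcon.1]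
        · by_cases h2 : g = h
          · rw [h2, inner_add_left, real_inner_smul_left, inner_neg_left, hfh]
            nlinarith [hcon.2]
          · exact (hts t ht.le le_rfl g ⟨hg, h1, h2⟩).le) b trivial
    rw [inner_add_left, real_inner_smul_left, inner_neg_left, hb] at h1
    nlinarith [real_inner_self_pos.2 (hα.ne_zero b)]
  rcases hpos with hpos | hpos
  · obtain ⟨l, hl, hlev, hfl, hlt⟩ := step i hi hfi hbi hpos
    obtain ⟨u, v, h1, h2⟩ := ih l hlt hfl
    refine ⟨u + 1, v, ?_, ?_⟩
    · rw [← sub_add_cancel (α b) (α i), ← hl, h1]; push_cast; module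
    · push_cast; linarith
  · obtain ⟨l, hl, hlev, hfl, hlt⟩ := step h hh hfh hbh hpos
    obtain ⟨u, v, h1, h2⟩ := ih l hlt hfl
    refine ⟨u, v + 1, ?_, ?_⟩
    · rw [← sub_add_cancel (α b) (α h), ← hl, h1]; push_cast; module
    · push_cast; linarith

end Alcove

/-! ### The floors of a region -/

section Floors

variable {ι V : Type*} [NormedAddCommGroup V] [InnerProductSpace ℝ V]
  {α : ι → V} {E : ι → ℤ → Prop} {x : V}

/-- Some vector is orthogonal to one root and to no other root apart from its negative. -/
lemma exists_orthogonal_forall_inner_ne_zero [Finite ι] (hα : IsRootFamily α) (i : ι) :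
    ∃ v : V, inner ℝ v (α i) = 0 ∧ ∀ j, j ≠ i → α j ≠ -α i → inner ℝ v (α j) ≠ 0 := by
  obtain ⟨v, hv, hvj⟩ := Module.Dual.exists_forall_mem_ne_zero_of_forall_exists
    (LinearMap.ker (innerₛₗ ℝ (α i)))
    (fun j : {j : ι // j ≠ i ∧ α j ≠ -α i} => innerₛₗ ℝ (α j.1)) (by
      rintro ⟨j, hji, hj⟩
      obtain ⟨d, hd, hdj⟩ := exists_orthogonal_inner_neg (hα.ne_zero i) (b := α j)
        (fun c hc => (hα.eq_or_neg i j c hc).elim hji hj)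
      refine ⟨d, ?_, ?_⟩
      · rw [LinearMap.mem_ker, innerₛₗ_apply_apply, real_inner_comm, hd]
      · rw [innerₛₗ_apply_apply, real_inner_comm]
        exact hdj.ne)
  refine ⟨v, ?_, fun j hji hj => ?_⟩
  · rw [real_inner_comm]; exact hv
  · rw [real_inner_comm]; exact hvj ⟨j, hji, hj⟩

/-- A facet of a region contains a point that lies on no other hyperplane with integer level. -/
lemma IsRegionFacet.exists_generic [Finite ι] (hα : IsRootFamily α) {i : ι} {n : ℤ}
    (hF : IsRegionFacet α E x i n) :
    ∃ p : V, inner ℝ p (α i) = n ∧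
      (∀ j, j ≠ i → α j ≠ -α i → ∀ d : ℤ, inner ℝ p (α j) ≠ d) ∧
      ∀ j (l : ℤ), E j l → (l : ℝ) < inner ℝ x (α j) → j ≠ i → (l : ℝ) < inner ℝ p (α j) := by
  obtain ⟨-, -, p, hp, hpj⟩ := hF
  obtain ⟨v, hv, hvj⟩ := exists_orthogonal_forall_inner_ne_zero hα i
  -- All relevant levels of a root other than `i` are integers below `⟨p, α j⟩`.
  obtain ⟨t, ht, -, hts⟩ := exists_pos_forall_lt_inner_add_smul (α := α) p v {j | j ≠ i}
    (fun j => ((⌈(inner ℝ p (α j) : ℝ)⌉ - 1 : ℤ) : ℝ))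
    (fun j _ => by push_cast; linarith [Int.ceil_lt_add_one (inner ℝ p (α j) : ℝ)]) one_pos
  -- Each further hyperplane excludes at most one parameter on the segment.
  set bad : Set ℝ := ⋃ (j : {j : ι // j ≠ i ∧ α j ≠ -α i}) (d : ℤ),
    {s | inner ℝ (p + s • v) (α j.1) = d} with hbad
  have hcount : bad.Countable := by
    have : Countable ι := Finite.to_countable
    refine Set.countable_iUnion fun j => Set.countable_iUnion fun d => ?_
    refine Set.Subsingleton.countable fun s hs s' hs' => ?_
    have h1 : inner ℝ (p + s • v) (α j.1) = d := hs
    have h2 : inner ℝ (p + s' • v) (α j.1) = d := hs'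
    rw [inner_add_left, real_inner_smul_left] at h1 h2
    exact mul_right_cancel₀ (hvj j.1 j.2.1 j.2.2) (by linarith)
  obtain ⟨s, hs, hst⟩ := (hcount.dense_compl ℝ).exists_mem_open isOpen_Ioo
    (Set.nonempty_Ioo.2 ht)
  refine ⟨p + s • v, ?_, fun j hji hj d hd => hs ?_, fun j l hE hl hji => ?_⟩
  · rw [inner_add_left, real_inner_smul_left, hv, hp, mul_zero, add_zero]
  · exact Set.mem_iUnion₂.2 ⟨⟨j, hji, hj⟩, d, hd⟩
  · refine lt_of_le_of_lt (Int.cast_le.2 ?_) (hts s hst.1.le hst.2.le j hji)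
    have := Int.lt_ceil.2 (hpj j l hE hl (Or.inl hji))
    omega

/-- A point on a facet of level `1` of a region that lies on no other hyperplane with integer level
is a limit of points of an alcove in the region with this facet. -/
lemma exists_isFacet_of_wall_point [Finite ι] (hα : IsRootFamily α)
    (hE : ∀ i n, E i n → n ≤ 1) {i : ι} {p : V} (hp : inner ℝ p (α i) = 1)
    (hpj : ∀ j, j ≠ i → α j ≠ -α i → ∀ d : ℤ, inner ℝ p (α j) ≠ d)
    (hpE : ∀ j (l : ℤ), E j l → (l : ℝ) < inner ℝ x (α j) → j ≠ i → (l : ℝ) < inner ℝ p (α j)) :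
    ∃ q, IsGeneric α q ∧ q ∈ levelRegion α E x ∧ ⌊(inner ℝ q (α i) : ℝ)⌋ = 1 ∧
      IsFacet α Set.univ (levels α q) i ∧
      ∀ j, j ≠ i → ⌊(inner ℝ q (α j) : ℝ)⌋ = ⌈(inner ℝ p (α j) : ℝ)⌉ - 1 := by
  obtain ⟨q, hqg, hqi, hqj⟩ := exists_generic_above_wall hα (n := 1) (by simpa using hp) hpj
  refine ⟨q, hqg, fun j l hEl hl => ?_, hqi, ⟨trivial, p, ?_, fun j _ hji => ?_⟩, hqj⟩
  · refine lt_of_le_of_lt (Int.cast_le.2 ?_) (hqg.floor_lt j)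
    rcases eq_or_ne j i with rfl | hji
    · rw [hqi]; exact hE _ _ hEl
    · have := Int.lt_ceil.2 (hpE j l hEl hl hji)
      rw [hqj j hji]
      omega
  · rw [levels, hqi, hp, Int.cast_one]
  · rw [levels, hqj j hji]
    push_cast
    linarith [Int.ceil_lt_add_one (inner ℝ p (α j) : ℝ)]

/-- The descent step. An alcove of the region that has `⟨y, α i⟩ = 1` as a facet and is not the
minimal alcove has a facet `⟨y, α h⟩ = m` separating it from the minimal one. On the other side of
the face in which these two facets meet there is an alcove of the region with the same facet
`⟨y, α i⟩ = 1` and smaller levels. -/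
lemma exists_sum_natAbs_lt [Fintype ι] (hα : IsRootFamily α)
    (hE : ∀ i n, E i n → n ≤ 1)
    (hEneg : ∀ i j n, α j = -α i → E i n → E j (-n)) (hx : IsGeneric α x)
    (hmin : ∀ y, IsGeneric α y → y ∈ levelRegion α E x → ∀ i, 0 < inner ℝ x (α i) →
      ⌊(inner ℝ x (α i) : ℝ)⌋ ≤ ⌊(inner ℝ y (α i) : ℝ)⌋)
    {i : ι} (hxi : 1 < inner ℝ x (α i)) {q : V} (hq : IsGeneric α q)
    (hqR : q ∈ levelRegion α E x) (hqi : ⌊(inner ℝ q (α i) : ℝ)⌋ = 1)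
    (hi : IsFacet α Set.univ (levels α q) i)
    (hxq : x ∉ openPolyhedron α Set.univ (levels α q)) :
    ∃ q', IsGeneric α q' ∧ q' ∈ levelRegion α E x ∧ ⌊(inner ℝ q' (α i) : ℝ)⌋ = 1 ∧
      IsFacet α Set.univ (levels α q') i ∧
      ∑ j, ⌊(inner ℝ q' (α j) : ℝ)⌋.natAbs < ∑ j, ⌊(inner ℝ q (α j) : ℝ)⌋.natAbs := by
  -- A facet `h` of the alcove of `q` separates it from `x`.
  obtain ⟨h, hh, hxh⟩ : ∃ h, IsFacet α Set.univ (levels α q) h ∧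
      inner ℝ x (α h) ≤ levels α q h := by
    by_contra! hcon
    exact hxq (mem_openPolyhedron_of_forall_isFacet hα.ne_zero hα.eq_or_neg
      hq.mem_openPolyhedron hcon)
  obtain ⟨h', hh'⟩ := hα.neg_mem h
  set m : ℤ := ⌊(inner ℝ q (α h) : ℝ)⌋ with hm
  have hxm : inner ℝ x (α h) < m := hxh.lt_of_ne (hx h m)
  -- By minimality of the alcove of `x`, it is approached when crossing `h` downwards.
  have hxpos : 0 < inner ℝ x (α h) := by
    by_contra! hle
    have hlt : inner ℝ x (α h) < 0 := hle.lt_of_ne (by simpa using hx h 0)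
    have h1 := hmin q hq hqR h' (by rw [hh', inner_neg_right]; linarith)
    rw [hq.floor_neg hh', hx.floor_neg hh', ← hm] at h1
    have h2 : m ≤ ⌊(inner ℝ x (α h) : ℝ)⌋ := by omega
    have h3 := Int.floor_le (inner ℝ x (α h) : ℝ)
    have h4 : (m : ℝ) ≤ ⌊(inner ℝ x (α h) : ℝ)⌋ := by exact_mod_cast h2
    linarith
  have hm1 : 1 ≤ m := by
    have : (0 : ℝ) < m := hxpos.trans hxm
    exact_mod_cast this
  have hEh : ¬ E h m := by
    intro hcon
    have h1 := hqR h' (-m) (hEneg h h' m hh' hcon)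
      (by rw [hh', inner_neg_right]; push_cast; linarith)
    rw [hh', inner_neg_right] at h1
    push_cast at h1
    linarith [hq.floor_lt h]
  have hih : i ≠ h := by
    rintro rfl
    rw [hm, hqi, Int.cast_one] at hxm
    linarith
  have hneg : α h ≠ -α i := by
    intro hcon
    rw [hcon, inner_neg_right] at hxpos
    linarith
  obtain ⟨f, hfi, hfh, hf⟩ := exists_mem_inter_of_isFacet hα hq hih hneg hi hh
  have hle : ∀ j, levels α q j ≤ inner ℝ f (α j) := fun j =>
    le_inner_of_forall_isFacet hα.ne_zero hα.eq_or_neg hq.mem_openPolyhedron (fun g hg => by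
      by_cases h1 : g = i
      · exact (h1 ▸ hfi).ge
      · by_cases h2 : g = h
        · exact (h2 ▸ hfh).ge
        · exact (hf g hg h1 h2).le) j trivial
  -- Move from the face inside the facet `i`, away from the alcove of `q`.
  obtain ⟨d, hdi, hdh⟩ := exists_orthogonal_inner_neg (hα.ne_zero i) (b := α h)
    (fun c hc => (hα.eq_or_neg i h c hc).elim hih.symm hneg)
  obtain ⟨t₁, ht₁, -, hts₁⟩ := exists_pos_forall_lt_inner_add_smul f d
    {j | levels α q j < inner ℝ f (α j)} (levels α q) (fun j hj => hj) one_pos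
  obtain ⟨t, ht, htt₁, hts₂⟩ := exists_pos_forall_lt_inner_add_smul (α := α) f d
    Set.univ (fun j => levels α q j - 1) (fun j _ => by linarith [hle j]) ht₁
  set p : V := f + t • d with hp
  have hpi : inner ℝ p (α i) = 1 := by
    rw [hp, inner_add_left, real_inner_smul_left, hdi, hfi, levels, hqi]; simp
  have hout : ∀ j, inner ℝ f (α j) ≠ levels α q j → levels α q j < inner ℝ p (α j) :=
    fun j hj => hts₁ t ht.le htt₁.le j ((hle j).lt_of_ne hj.symm)
  have hlow : ∀ j, levels α q j - 1 < inner ℝ p (α j) :=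
    fun j => hts₂ t ht.le le_rfl j trivial
  -- A hyperplane through the face, other than that of `i`, is crossed; its level is positive, and
  -- equal to one only for a hyperplane that is not in the arrangement.
  have hcross : ∀ j, j ≠ i → inner ℝ f (α j) = levels α q j →
      inner ℝ p (α j) < levels α q j ∧ 1 ≤ ⌊(inner ℝ q (α j) : ℝ)⌋ ∧
        ¬ E j ⌊(inner ℝ q (α j) : ℝ)⌋ := by
    intro j hji hfj
    obtain ⟨u, v, huv, hlev⟩ := exists_nat_combination hα hq hi hh hfi hfh hf j hfj
    rw [hqi, mul_one, ← hm] at hlev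
    have hv : v ≠ 0 := by
      rintro rfl
      rw [Nat.cast_zero, zero_smul, add_zero] at huv
      rcases hα.eq_or_neg i j _ huv with h1 | h1
      · exact hji h1
      · rw [h1, eq_comm, ← neg_one_smul ℝ (α i)] at huv
        have h2 := smul_left_injective ℝ (hα.ne_zero i) huv
        have h3 : (0 : ℝ) ≤ u := Nat.cast_nonneg u
        change (u : ℝ) = -1 at h2
        linarith
    have hv1 : (1 : ℤ) ≤ v := by exact_mod_cast Nat.one_le_iff_ne_zero.2 hv
    have hvm : (v : ℤ) ≤ v * m := le_mul_of_one_le_right (by omega) hm1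
    have hmv : m ≤ v * m := le_mul_of_one_le_left (by omega) hv1
    refine ⟨?_, by omega, fun hEj => ?_⟩
    · have h1 : inner ℝ d (α j) = v * inner ℝ d (α h) := by
        rw [huv, inner_add_right, real_inner_smul_right, real_inner_smul_right, hdi]; ring
      rw [hp, inner_add_left, real_inner_smul_left, hfj, h1]
      have h2 : (0 : ℝ) < v := by exact_mod_cast Nat.pos_of_ne_zero hv
      nlinarith [mul_neg_of_pos_of_neg (mul_pos ht h2) hdh]
    · have h1 := hE _ _ hEj
      have hu0 : u = 0 := by omega
      have hv0 : v = 1 := by omega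
      have hjh : j = h := hα.injective (by rw [huv, hu0, hv0]; simp)
      exact hEh (by rw [hjh] at hEj; exact hEj)
  have hi' : ∀ j, α j = -α i → inner ℝ f (α j) ≠ levels α q j := by
    intro j hj
    rw [hj, inner_neg_right, hfi, levels, levels, hq.floor_neg hj, hqi]
    norm_num
  -- The levels just below `p`.
  have hlevel : ∀ j, j ≠ i → α j ≠ -α i →
      (∀ e : ℤ, inner ℝ p (α j) ≠ e) ∧
      (⌈(inner ℝ p (α j) : ℝ)⌉ - 1).natAbs ≤ ⌊(inner ℝ q (α j) : ℝ)⌋.natAbs ∧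
      (inner ℝ f (α j) = levels α q j →
        (⌈(inner ℝ p (α j) : ℝ)⌉ - 1).natAbs < ⌊(inner ℝ q (α j) : ℝ)⌋.natAbs) := by
    intro j hji hj
    have hmain : ∀ k : ℤ, (k : ℝ) < inner ℝ p (α j) → inner ℝ p (α j) < k + 1 →
        (∀ e : ℤ, inner ℝ p (α j) ≠ e) ∧ ⌈(inner ℝ p (α j) : ℝ)⌉ - 1 = k := by
      intro k h1 h2
      refine ⟨fun e he => ?_, ?_⟩
      · rw [he] at h1 h2
        norm_cast at h1 h2
        omega
      · have : ⌈(inner ℝ p (α j) : ℝ)⌉ = k + 1 :=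
          Int.ceil_eq_iff.2 ⟨by push_cast; linarith, by push_cast; linarith⟩
        omega
    obtain ⟨j', hj'⟩ := hα.neg_mem j
    have hj'i : j' ≠ i := by
      rintro rfl; exact hj (by rw [hj', neg_neg])
    have hpj' : inner ℝ p (α j') = -inner ℝ p (α j) := by rw [hj', inner_neg_right]
    have hlj' : levels α q j' = -levels α q j - 1 := by
      rw [levels, hq.floor_neg hj', levels]; push_cast; ring
    by_cases hfj : inner ℝ f (α j) = levels α q j
    · obtain ⟨h1, h2, -⟩ := hcross j hji hfj
      have h3 := hlow j
      simp only [levels] at h1 h3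
      obtain ⟨h4, h5⟩ := hmain (⌊(inner ℝ q (α j) : ℝ)⌋ - 1) (by push_cast; linarith)
        (by push_cast; linarith)
      rw [h5]
      exact ⟨h4, by omega, fun _ => by omega⟩
    · have h1 := hout j hfj
      simp only [levels] at h1
      by_cases hfj' : inner ℝ f (α j') = levels α q j'
      · obtain ⟨h2, h3, -⟩ := hcross j' hj'i hfj'
        have h4 := hlow j'
        rw [hlj', hpj'] at h2 h4
        rw [hq.floor_neg hj'] at h3
        simp only [levels] at h2 h4
        obtain ⟨h5, h6⟩ := hmain (⌊(inner ℝ q (α j) : ℝ)⌋ + 1) (by push_cast; linarith)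
          (by push_cast; linarith)
        rw [h6]
        exact ⟨h5, by omega, fun h => absurd h hfj⟩
      · have h2 := hout j' hfj'
        rw [hlj', hpj'] at h2
        simp only [levels] at h2
        obtain ⟨h5, h6⟩ := hmain ⌊(inner ℝ q (α j) : ℝ)⌋ h1 (by linarith)
        rw [h6]
        exact ⟨h5, le_rfl, fun h => absurd h hfj⟩
  obtain ⟨q', hq'g, hq'R, hq'i, hq'F, hq'j⟩ := exists_isFacet_of_wall_point (x := x) hα hE hpi
    (fun j hji hj => (hlevel j hji hj).1) (by
      intro j l hEl hl hji
      have h1 : l ≤ ⌊(inner ℝ q (α j) : ℝ)⌋ := Int.le_floor.2 (hqR j l hEl hl).le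
      by_cases hfj : inner ℝ f (α j) = levels α q j
      · have h2 : l ≠ ⌊(inner ℝ q (α j) : ℝ)⌋ := by
          rintro rfl; exact (hcross j hji hfj).2.2 hEl
        have h3 : (l : ℝ) ≤ levels α q j - 1 := by
          have : l ≤ ⌊(inner ℝ q (α j) : ℝ)⌋ - 1 := by omega
          rw [levels]
          exact_mod_cast this
        exact h3.trans_lt (hlow j)
      · exact lt_of_le_of_lt (Int.cast_le.2 h1) (hout j hfj))
  refine ⟨q', hq'g, hq'R, hq'i, hq'F, Finset.sum_lt_sum (fun j _ => ?_)
    ⟨h, Finset.mem_univ h, ?_⟩⟩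
  · rcases eq_or_ne j i with rfl | hji
    · rw [hq'i, hqi]
    · by_cases hj : α j = -α i
      · rw [hq'g.floor_neg hj, hq.floor_neg hj, hq'i, hqi]
      · rw [hq'j j hji]
        exact (hlevel j hji hj).2.1
  · rw [hq'j h hih.symm]
    exact (hlevel h hih.symm hneg).2.2 hfh

/-- Every floor of the region is a floor of its minimal alcove: among the alcoves of the region
having this floor, one of least total level must be the minimal alcove. -/
theorem isRegionFacet_true_of_isRegionFacet [Finite ι] (hα : IsRootFamily α)
    (hE : ∀ i n, E i n → n ≤ 1)
    (hEneg : ∀ i j n, α j = -α i → E i n → E j (-n)) (hx : IsGeneric α x)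
    (hmin : ∀ y, IsGeneric α y → y ∈ levelRegion α E x → ∀ i, 0 < inner ℝ x (α i) →
      ⌊(inner ℝ x (α i) : ℝ)⌋ ≤ ⌊(inner ℝ y (α i) : ℝ)⌋)
    {i : ι} {n : ℤ} (hF : IsRegionFacet α E x i n) (hn : 0 < n) :
    IsRegionFacet α (fun _ _ => True) x i n := by
  have := Fintype.ofFinite ι
  obtain rfl : n = 1 := le_antisymm (hE i n hF.1) hn
  have hxi : 1 < inner ℝ x (α i) := by simpa using hF.2.1
  obtain ⟨p, hp, hpj, hpE⟩ := hF.exists_generic hα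
  obtain ⟨q₀, hq₀, hq₀R, hq₀i, hq₀F, -⟩ :=
    exists_isFacet_of_wall_point (x := x) hα hE (by simpa using hp) hpj hpE
  obtain ⟨q, ⟨hq, hqR, hqi, hqF⟩, hqmin⟩ :=
    (measure fun q : V => ∑ j, ⌊(inner ℝ q (α j) : ℝ)⌋.natAbs).wf.has_min
      {q | IsGeneric α q ∧ q ∈ levelRegion α E x ∧ ⌊(inner ℝ q (α i) : ℝ)⌋ = 1 ∧
        IsFacet α Set.univ (levels α q) i} ⟨q₀, hq₀, hq₀R, hq₀i, hq₀F⟩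
  have hxq : x ∈ openPolyhedron α Set.univ (levels α q) := by
    by_contra hxq
    obtain ⟨q', h1, h2, h3, h4, hlt⟩ :=
      exists_sum_natAbs_lt hα hE hEneg hx hmin hxi hq hqR hqi hqF hxq
    exact hqmin q' ⟨h1, h2, h3, h4⟩ hlt
  have hfl := floor_eq_of_mem_openPolyhedron hα hq hxq
  have hlev : levels α x = levels α q := funext fun j => by rw [levels, hfl, levels]
  exact (isRegionFacet_true_iff hx i 1).2 ⟨by rw [hfl, hqi], hlev ▸ hqF⟩

end Floors

/-! ### Shi regions and alcoves -/

namespace ShiArrangement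

variable {ι V : Type*} [NormedAddCommGroup V] [InnerProductSpace ℝ V]

/-- The roots of a reduced crystallographic root system in a Euclidean space form a root family. -/
lemma isRootFamily_root [Finite ι] {P : RootPairing ι ℝ V V} (hP : IsEuclidean P)
    [P.IsCrystallographic] [P.IsReduced] : IsRootFamily P.root where
  ne_zero i := P.ne_zero i
  eq_or_neg i j c h := by
    by_contra! hcon
    have := RootPairing.IsReduced.linearIndependent P hcon.1 hcon.2
    rw [LinearIndependent.pair_iff] at this
    have := this 1 (-c) (by rw [h]; module)
    simp at this
  neg_mem i := ⟨P.reflectionPerm i i, by simp⟩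
  sub_mem i j hij hpos := by
    have h1 : 0 < P.pairing i j := by
      rw [← P.root_coroot_eq_pairing, hP.coroot_eq, map_smul, smul_eq_mul]
      have h2 : 0 < inner ℝ (P.root j) (P.root j) := real_inner_self_pos.2 (P.ne_zero j)
      erw [hP.toLinearMap_apply]
      positivity
    have h2 : 0 < P.pairingIn ℤ i j := by
      rw [← P.algebraMap_pairingIn ℤ, eq_intCast] at h1
      exact_mod_cast h1
    exact P.root_sub_root_mem_of_pairingIn_pos h2 hij

/-- The arrangement of the hyperplanes `⟨x, α i⟩ = n` with `E i n`. -/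
def levelArrangement (α : ι → V) (E : ι → ℤ → Prop) : Set (Set V) :=
  {H | ∃ i n, E i n ∧ H = hyperplane (α i) (n : ℤ)}

lemma mem_complement_levelArrangement {α : ι → V} {E : ι → ℤ → Prop} {x : V} :
    x ∈ complement (levelArrangement α E) ↔ ∀ i n, E i n → inner ℝ x (α i) ≠ (n : ℤ) := by
  constructor
  · exact fun h i n hE heq => h ⟨_, ⟨i, n, hE, rfl⟩, heq⟩
  · rintro h ⟨H, ⟨i, n, hE, rfl⟩, hx⟩
    exact h i n hE hx

/-- The connected components of the complement are the regions given by inequalities. -/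
lemma connectedComponentIn_complement_eq_levelRegion {α : ι → V} {E : ι → ℤ → Prop}
    (hneg : ∀ i, ∃ j, α j = -α i) (hEneg : ∀ i j n, α j = -α i → E i n → E j (-n)) {x : V}
    (hx : x ∈ complement (levelArrangement α E)) :
    connectedComponentIn (complement (levelArrangement α E)) x = levelRegion α E x := by
  apply Set.Subset.antisymm
  · intro y hy i n hE hn
    by_contra! hle
    have hord := ((isPreconnected_connectedComponentIn
      (F := complement (levelArrangement α E)) (x := x)).image
      (fun y => inner ℝ y (α i)) (by fun_prop)).ordConnected
    obtain ⟨z, hz, hzn⟩ := hord.out ⟨y, hy, rfl⟩ ⟨x, mem_connectedComponentIn hx, rfl⟩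
      ⟨hle, hn.le⟩
    exact mem_complement_levelArrangement.1 (connectedComponentIn_subset _ _ hz) i n hE hzn
  · obtain ⟨J, k, hR, -⟩ := exists_levelRegion_eq_openPolyhedron α E x
    refine IsPreconnected.subset_connectedComponentIn ?_ mem_levelRegion_self ?_
    · rw [hR]
      exact convex_openPolyhedron.isPreconnected
    · intro y hy
      refine mem_complement_levelArrangement.2 fun i n hE heq => ?_
      rcases lt_or_gt_of_ne (mem_complement_levelArrangement.1 hx i n hE) with h | h
      · obtain ⟨j, hj⟩ := hneg i
        have := hy j (-n) (hEneg i j n hj hE)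
          (by rw [hj, inner_neg_right]; push_cast; linarith)
        rw [hj, inner_neg_right, heq] at this
        push_cast at this
        linarith
      · exact absurd heq (hy i n hE h).ne'

/-- The levels of the Shi arrangement, for all roots: since `⟨x, α⟩ = 1` is the hyperplane
`⟨x, -α⟩ = -1`, a negative root has the levels `0` and `-1`. -/
def IsShiLevel {P : RootPairing ι ℝ V V} (b : P.Base) (i : ι) (n : ℤ) : Prop :=
  n = 0 ∨ (n = 1 ∧ b.IsPos i) ∨ (n = -1 ∧ ¬ b.IsPos i)

lemma isPos_iff_not_of_root_eq_neg {P : RootPairing ι ℝ V V} (b : P.Base) {i j : ι}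
    (h : P.root j = -P.root i) : b.IsPos j ↔ ¬ b.IsPos i := by
  have : j = P.reflectionPerm i i := P.root.injective (by simpa using h)
  rw [this]
  exact RootPairing.Base.IsPos.neg_iff_not b i

lemma isShiLevel_neg {P : RootPairing ι ℝ V V} (b : P.Base) (i j : ι) (n : ℤ)
    (h : P.root j = -P.root i) (hn : IsShiLevel b i n) : IsShiLevel b j (-n) := by
  unfold IsShiLevel at *
  rw [isPos_iff_not_of_root_eq_neg b h]
  rcases hn with rfl | ⟨rfl, h1⟩ | ⟨rfl, h1⟩
  · simp
  · simp [h1]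
  · simp [h1]

lemma hyperplane_neg (a : V) (c : ℝ) : hyperplane (-a) (-c) = hyperplane a c := by
  ext x
  simp [hyperplane]

lemma shiArrangement_eq_levelArrangement {P : RootPairing ι ℝ V V} (b : P.Base) :
    shiArrangement b = levelArrangement P.root (IsShiLevel b) := by
  ext H
  constructor
  · rintro ⟨i, hi, rfl | rfl⟩
    · exact ⟨i, 0, Or.inl rfl, by simp⟩
    · exact ⟨i, 1, Or.inr (Or.inl ⟨rfl, hi⟩), by simp⟩
  · rintro ⟨i, n, hn, rfl⟩
    have hroot : P.root (P.reflectionPerm i i) = -P.root i := by simp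
    by_cases hi : b.IsPos i
    · rcases hn with rfl | ⟨rfl, -⟩ | ⟨-, h⟩
      · exact ⟨i, hi, Or.inl (by simp)⟩
      · exact ⟨i, hi, Or.inr (by simp)⟩
      · exact absurd hi h
    · refine ⟨P.reflectionPerm i i, (isPos_iff_not_of_root_eq_neg b hroot).2 hi, ?_⟩
      rw [hroot]
      rcases hn with rfl | ⟨-, h⟩ | ⟨rfl, -⟩
      · exact Or.inl (by rw [← hyperplane_neg]; simp)
      · exact absurd h hi
      · exact Or.inr (by rw [← hyperplane_neg]; simp)

lemma affineCoxeterArrangement_eq_levelArrangement (P : RootPairing ι ℝ V V) :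
    affineCoxeterArrangement P = levelArrangement P.root (fun _ _ => True) := by
  ext H
  simp [affineCoxeterArrangement, levelArrangement]

lemma mem_complement_affineCoxeterArrangement {P : RootPairing ι ℝ V V} {x : V} :
    x ∈ complement (affineCoxeterArrangement P) ↔ IsGeneric P.root x := by
  rw [affineCoxeterArrangement_eq_levelArrangement, mem_complement_levelArrangement]
  simp [IsGeneric]

/-- The alcove of a generic point, and its levels. -/
lemma isAlcove_levelRegion [Finite ι] {P : RootPairing ι ℝ V V} (hα : IsRootFamily P.root)
    {x : V} (hx : IsGeneric P.root x) :
    IsAlcove P (levelRegion P.root (fun _ _ => True) x) ∧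
      ∀ i, level P (levelRegion P.root (fun _ _ => True) x) i =
        ⌊(inner ℝ x (P.root i) : ℝ)⌋ := by
  have hx' := mem_complement_affineCoxeterArrangement.2 hx
  have hA : IsAlcove P (levelRegion P.root (fun _ _ => True) x) := by
    refine ⟨x, hx', ?_⟩
    rw [affineCoxeterArrangement_eq_levelArrangement] at hx' ⊢
    exact (connectedComponentIn_complement_eq_levelRegion hα.neg_mem
      (fun _ _ _ _ _ => trivial) hx').symm
  refine ⟨hA, fun i => ?_⟩
  obtain ⟨h1, h2⟩ := level_spec hA i x mem_levelRegion_self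
  exact (Int.floor_eq_iff.2 ⟨h1.le, h2⟩).symm

end ShiArrangement

theorem mainTheorem4 {ι V : Type*} [Finite ι] [NormedAddCommGroup V] [InnerProductSpace ℝ V]
    (P : RootPairing ι ℝ V V) (hP : ShiArrangement.IsEuclidean P)
    [P.IsRootSystem] [P.IsCrystallographic] [P.IsReduced] [P.IsIrreducible]
    (b : P.Base) (R A : Set V) (hR : ShiArrangement.IsShiRegion b R)
    (hA : ShiArrangement.IsMinimalAlcove b R A) :
    {H : Set V | ShiArrangement.IsFloor A H} = {H : Set V | ShiArrangement.IsFloor R H} := by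
  open ShiArrangement in
  have hα : IsRootFamily P.root := isRootFamily_root hP
  have hEneg := isShiLevel_neg b
  obtain ⟨⟨x, hx', rfl⟩, hAR, hmin⟩ := hA
  have hx := mem_complement_affineCoxeterArrangement.1 hx'
  have hxR : x ∈ R := hAR (mem_connectedComponentIn hx')
  have hAx : connectedComponentIn (complement (affineCoxeterArrangement P)) x =
      levelRegion P.root (fun _ _ => True) x := by
    rw [affineCoxeterArrangement_eq_levelArrangement] at hx' ⊢
    exact connectedComponentIn_complement_eq_levelRegion hα.neg_mem
      (fun _ _ _ _ _ => trivial) hx'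
  have hRx : R = levelRegion P.root (IsShiLevel b) x := by
    obtain ⟨y, hy, rfl⟩ := hR
    rw [connectedComponentIn_eq hxR]
    have hxc := connectedComponentIn_subset _ _ hxR
    rw [shiArrangement_eq_levelArrangement] at hxc ⊢
    exact connectedComponentIn_complement_eq_levelRegion hα.neg_mem hEneg hxc
  rw [hAx] at hmin ⊢
  -- On the roots that are positive on `R`, minimality compares the levels themselves.
  have hmin' : ∀ y, IsGeneric P.root y → y ∈ levelRegion P.root (IsShiLevel b) x →
      ∀ i, 0 < inner ℝ x (P.root i) →
        ⌊(inner ℝ x (P.root i) : ℝ)⌋ ≤ ⌊(inner ℝ y (P.root i) : ℝ)⌋ := by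
    intro y hy hyR i hi
    obtain ⟨hB, hBl⟩ := isAlcove_levelRegion hα hy
    have hBR : levelRegion P.root (fun _ _ => True) y ⊆ R := by
      rw [hRx]
      exact fun z hz j n hn hxn => hz j n trivial (hyR j n hn hxn)
    have hyi : 0 < inner ℝ y (P.root i) := by
      simpa using hyR i 0 (Or.inl rfl) (by simpa using hi)
    have h1 : 0 ≤ ⌊(inner ℝ x (P.root i) : ℝ)⌋ := Int.floor_nonneg.2 hi.le
    have h2 : 0 ≤ ⌊(inner ℝ y (P.root i) : ℝ)⌋ := Int.floor_nonneg.2 hyi.le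
    by_cases hpos : b.IsPos i
    · have h3 := hmin _ hB hBR i hpos
      rwa [(isAlcove_levelRegion hα hx).2, hBl, abs_of_nonneg h1, abs_of_nonneg h2] at h3
    · obtain ⟨j, hj⟩ := hα.neg_mem i
      have h3 := hmin _ hB hBR j ((isPos_iff_not_of_root_eq_neg b hj).2 hpos)
      rw [(isAlcove_levelRegion hα hx).2, hBl, hx.floor_neg hj, hy.floor_neg hj,
        abs_of_nonpos (by omega), abs_of_nonpos (by omega)] at h3
      omega
  have hE : ∀ i n, IsShiLevel b i n → n ≤ 1 := by
    rintro i n (rfl | ⟨rfl, -⟩ | ⟨rfl, -⟩) <;> norm_num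
  ext H
  change IsFloor _ H ↔ IsFloor R H
  rw [hRx, isFloor_levelRegion_iff hα, isFloor_levelRegion_iff hα]
  constructor
  · rintro ⟨i, n, hF, hn, rfl⟩
    exact ⟨i, n, isRegionFacet_of_isRegionFacet_true hα hx hmin' hF hn, hn, rfl⟩
  · rintro ⟨i, n, hF, hn, rfl⟩
    exact ⟨i, n, isRegionFacet_true_of_isRegionFacet hα hE hEneg hx hmin' hF hn, hn, rfl⟩
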